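/- **Theorem.** Let $n,k$ be integers with $1\le k\le n-1$ and let $V>0$. There is a constant $\gamma=\gamma(n,k,V)>1$, depending only on $n$, $k$ and $V$, such that the following holds. Let $\Omega\subset\mathbb{R}^n$ be a bounded open convex set with $0\in\Omega$ and volume $|\Omega|=V$, and let $u\in C^2(\Omega)\cap C^0(\overline\Omega)$ be a convex function with $$ S_k(D^2u)=1\ \text{ in }\Omega,\qquad u(0)=0,\quad Du(0)=0,\qquad u=1\ \text{ on }\partial\Omega, $$ where $S_k(D^2u)=\sum_{1\le i_1<\dots<i_k\le n}\lambda_{i_1}\cdots\lambda_{i_k}$ is the $k$-th elementary symmetric polynomial of the eigenvalues $\lambda_1,\dots,\lambda_n$ of the Hessian $D^2u$. Then $\Omega$ satisfies the $\gamma$-ball condition: there are $x_0\in\mathbb{R}^n$ and $R>0$ with $$ B_{\gamma^{-1}R}(x_0)\subset\Omega\subset B_{\gamma R}(x_0). $$ -/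

import Mathlib

open MeasureTheory

/-- The Hessian matrix `D²u(x)`, with entries `∂ᵢ∂ⱼu(x)` in the standard basis of `ℝⁿ`. -/
noncomputable def hessianMatrix {n : ℕ} (u : EuclideanSpace ℝ (Fin n) → ℝ)
    (x : EuclideanSpace ℝ (Fin n)) : Matrix (Fin n) (Fin n) ℝ :=
  Matrix.of fun i j =>
    fderiv ℝ (fderiv ℝ u) x (EuclideanSpace.single i 1) (EuclideanSpace.single j 1)

/-- `S_k(A)`: the `k`-th elementary symmetric polynomial of the eigenvalues of `A`, which are
counted with multiplicity as the roots of the characteristic polynomial. For a symmetric real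
matrix (such as the Hessian of a `C²` function) all `n` of these roots are real. -/
noncomputable def hessianS {n : ℕ} (k : ℕ) (A : Matrix (Fin n) (Fin n) ℝ) : ℝ :=
  A.charpoly.roots.esymm k

/-- The `γ`-ball condition for `Ω`: for some ball `B_R(x₀)`, its dilations about the centre `x₀`
satisfy `γ⁻¹ B_R ⊆ Ω ⊆ γ B_R`. -/
def GammaBallCondition {n : ℕ} (γ : ℝ) (Ω : Set (EuclideanSpace ℝ (Fin n))) : Prop :=
  ∃ (x₀ : EuclideanSpace ℝ (Fin n)) (R : ℝ), 0 < R ∧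
    Metric.ball x₀ (γ⁻¹ * R) ⊆ Ω ∧ Ω ⊆ Metric.ball x₀ (γ * R)

/-! A maximal simplex with one vertex at the origin gives linear coordinates `W` in which `Ω` lies
in the cube `[-1,1]^n` and contains a ball of fixed size. With `M = n⁻¹ WᵀW`, the form `x·Mx` is at
most 1 on `Ω`. Comparing `u` with `½ x·Mx` gives `S_k(M) ≤ 1`: their difference has an interior
minimum, where `D²u ≥ M`, and `S_k` is monotone on positive semidefinite matrices
(`hessianS_le_one_of_le_one`, `hessianS_le_add`). The volume bounds `det M` from below. As `k < n`,
these two bounds confine every eigenvalue of `M` to a fixed interval (`eigenvalues_mem_Icc`), so `W`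
distorts lengths by a controlled amount and the cube and ball give the two balls sought. -/

section LinearAlgebra

open Matrix Polynomial

variable {n : ℕ}

/-! ### Monotonicity of `S_k` and eigenvalue bounds. -/

theorem hessianS_eq_sum {A : Matrix (Fin n) (Fin n) ℝ} (hA : A.IsHermitian) (k : ℕ) :
    hessianS k A = ∑ t ∈ Finset.univ.powersetCard k, ∏ i ∈ t, hA.eigenvalues i := by
  rw [hessianS, hA.roots_charpoly_eq_eigenvalues, Finset.esymm_map_val]
  rfl

theorem hessianS_eq_coeff {A : Matrix (Fin n) (Fin n) ℝ} (hA : A.IsHermitian) {k : ℕ}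
    (hk : k ≤ n) :
    hessianS k A = (∏ i, (X + C (hA.eigenvalues i))).coeff (n - k) := by
  rw [hessianS_eq_sum hA, Finset.prod_X_add_C_coeff _ _ (by simp)]
  simp [Nat.sub_sub_self hk]

/-- The spectral theorem for real symmetric matrices, in terms of an orthogonal matrix. -/
theorem Matrix.IsHermitian.exists_orthogonal_diagonalization {A : Matrix (Fin n) (Fin n) ℝ}
    (hA : A.IsHermitian) :
    ∃ U : Matrix (Fin n) (Fin n) ℝ, U * Uᵀ = 1 ∧ Uᵀ * U = 1 ∧
      A = U * diagonal hA.eigenvalues * Uᵀ := by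
  have hU := hA.eigenvectorUnitary.2
  rw [Matrix.mem_unitaryGroup_iff] at hU
  have hU' := hA.eigenvectorUnitary.2
  rw [Matrix.mem_unitaryGroup_iff'] at hU'
  have hs : star (hA.eigenvectorUnitary : Matrix (Fin n) (Fin n) ℝ) =
      (hA.eigenvectorUnitary : Matrix (Fin n) (Fin n) ℝ)ᵀ := by
    rw [star_eq_conjTranspose, conjTranspose_eq_transpose_of_trivial]
  rw [hs] at hU hU'
  refine ⟨_, hU, hU', ?_⟩
  have h := hA.spectral_theorem
  rw [Unitary.conjStarAlgAut_apply, hs] at h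
  exact h

theorem det_smul_one_add_conj {U B : Matrix (Fin n) (Fin n) ℝ} (h : U * Uᵀ = 1) (t : ℝ) :
    (t • 1 + U * B * Uᵀ).det = (t • 1 + B).det := by
  have e : t • 1 + U * B * Uᵀ = U * (t • 1 + B) * Uᵀ := by
    rw [mul_add, add_mul, mul_smul_comm, mul_one, smul_mul_assoc, h]
  rw [e, det_mul, det_mul, mul_comm, ← mul_assoc, ← det_mul, mul_eq_one_comm.mp h, det_one, one_mul]

theorem Matrix.IsHermitian.eval_prod_X_add_eigenvalues {A : Matrix (Fin n) (Fin n) ℝ}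
    (hA : A.IsHermitian) (t : ℝ) :
    (∏ i, (X + C (hA.eigenvalues i))).eval t = (t • 1 + A).det := by
  obtain ⟨U, h, -, e⟩ := hA.exists_orthogonal_diagonalization
  conv_rhs => rw [e, det_smul_one_add_conj h, smul_one_eq_diagonal, diagonal_add, det_diagonal]
  simp [eval_prod]

theorem det_diagonal_add_vecMulVec {a : Fin n → ℝ} (ha : ∀ i, 0 < a i) (w : Fin n → ℝ) :
    (diagonal a + vecMulVec w w).det
      = ∏ i, a i + ∑ i, w i ^ 2 * ∏ j ∈ Finset.univ.erase i, a j := by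
  have hu : IsUnit (diagonal a).det := by
    rw [det_diagonal]; exact (Finset.prod_pos fun i _ => ha i).ne'.isUnit
  rw [vecMulVec_eq Unit, det_add_replicateCol_mul_replicateRow hu, det_diagonal]
  have : (diagonal a)⁻¹ = diagonal fun i => (a i)⁻¹ := by
    apply inv_eq_right_inv
    rw [diagonal_mul_diagonal, ← diagonal_one]
    congr 1; ext i; exact mul_inv_cancel₀ (ha i).ne'
  rw [this, det_unique, Matrix.add_apply, one_apply_eq, mul_add, mul_one]
  congr 1
  rw [mul_apply, Finset.mul_sum]
  refine Finset.sum_congr rfl fun i _ => ?_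
  rw [← Finset.mul_prod_erase _ a (Finset.mem_univ i), mul_diagonal]
  simp only [replicateRow_apply, replicateCol_apply]
  field_simp [(ha i).ne']

/-- In an eigenbasis of `A`, the matrix determinant lemma shows that the rank-one term adds to `∏ (X
+ λᵢ)` a nonnegative combination of products of `n - 1` of its factors, whose coefficients are
nonnegative. -/
theorem hessianS_le_add_vecMulVec {A : Matrix (Fin n) (Fin n) ℝ} (hA : A.PosSemidef)
    (v : Fin n → ℝ) {k : ℕ} (hk : k ≤ n) :
    hessianS k A ≤ hessianS k (A + vecMulVec v v) := by
  have hB : (A + vecMulVec v v).IsHermitian := by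
    refine hA.1.add ?_
    have := (posSemidef_vecMulVec_self_star v).1
    simpa using this
  obtain ⟨U, h, h', e⟩ := hA.1.exists_orthogonal_diagonalization
  set w := Uᵀ *ᵥ v with hw
  have key : (∏ i, (X + C (hB.eigenvalues i))) = (∏ i, (X + C (hA.1.eigenvalues i))) +
      ∑ i, C (w i ^ 2) * ∏ j ∈ Finset.univ.erase i, (X + C (hA.1.eigenvalues j)) := by
    apply Polynomial.eq_of_infinite_eval_eq
    -- For `t > 0` all `t + λᵢ` are positive, as the determinant formula requires.
    refine Set.Infinite.mono (s := Set.Ioi 0) ?_ (Set.Ioi_infinite 0)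
    intro t ht
    have hv : vecMulVec v v = U * vecMulVec w w * Uᵀ := by
      rw [mul_vecMulVec, vecMulVec_mul, vecMul_transpose, hw, mulVec_mulVec, h, one_mulVec]
    have e2 : A + vecMulVec v v = U * (diagonal hA.1.eigenvalues + vecMulVec w w) * Uᵀ := by
      rw [mul_add, add_mul, ← e, ← hv]
    rw [Set.mem_ofPred_eq, hB.eval_prod_X_add_eigenvalues, e2, det_smul_one_add_conj h, ← add_assoc,
      smul_one_eq_diagonal, diagonal_add, det_diagonal_add_vecMulVec]
    · simp [eval_prod, eval_finsetSum]
    · intro i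
      exact add_pos_of_pos_of_nonneg ht (hA.eigenvalues_nonneg i)
  rw [hessianS_eq_coeff hA.1 hk, hessianS_eq_coeff hB hk, key, coeff_add, finsetSum_coeff]
  refine le_add_of_nonneg_right (Finset.sum_nonneg fun i _ => ?_)
  rw [coeff_C_mul]
  refine mul_nonneg (sq_nonneg _) ?_
  -- The second case is `k = 0`, where the degree is too small.
  by_cases hc : n - k ≤ (Finset.univ.erase i).card
  · rw [Finset.prod_X_add_C_coeff _ _ hc]
    exact Finset.sum_nonneg fun t _ => Finset.prod_nonneg fun j _ => hA.eigenvalues_nonneg j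
  · rw [coeff_eq_zero_of_natDegree_lt]
    rw [natDegree_prod_of_monic _ _ fun j _ => monic_X_add_C _]
    simp only [natDegree_X_add_C, Finset.sum_const, smul_eq_mul, mul_one]
    omega

/-- The spectral theorem splits `D` into rank-one terms, which are added one at a time. -/
theorem hessianS_le_add {A D : Matrix (Fin n) (Fin n) ℝ} (hA : A.PosSemidef) (hD : D.PosSemidef)
    {k : ℕ} (hk : k ≤ n) : hessianS k A ≤ hessianS k (A + D) := by
  obtain ⟨U, h, h', e⟩ := hD.1.exists_orthogonal_diagonalization
  set v : Fin n → Fin n → ℝ := fun i j => √(hD.1.eigenvalues i) * U j i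
  have hsum : D = ∑ i, vecMulVec (v i) (v i) := by
    conv_lhs => rw [e]
    ext a b
    rw [mul_apply, Matrix.sum_apply]
    refine Finset.sum_congr rfl fun i _ => ?_
    rw [mul_diagonal, transpose_apply, vecMulVec_apply]
    simp only [v]
    rw [mul_mul_mul_comm, Real.mul_self_sqrt (hD.eigenvalues_nonneg i)]
    ring
  suffices H : ∀ s : Finset (Fin n), (A + ∑ i ∈ s, vecMulVec (v i) (v i)).PosSemidef ∧
      hessianS k A ≤ hessianS k (A + ∑ i ∈ s, vecMulVec (v i) (v i)) by
    rw [hsum]; exact (H _).2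
  intro s
  induction s using Finset.induction_on with
  | empty => simpa using hA
  | insert i s hi ih =>
    rw [Finset.sum_insert hi, add_comm (vecMulVec _ _), ← add_assoc]
    refine ⟨ih.1.add (by simpa using posSemidef_vecMulVec_self_star (v i)),
      ih.2.trans (hessianS_le_add_vecMulVec ih.1 _ hk)⟩

/-- If all products of `k` of the numbers `f i ≥ 0` are at most one, then so are all products of
at least `k` of them. -/
theorem prod_le_one_of_card_ge {ι : Type*} [DecidableEq ι] {f : ι → ℝ} (hf : ∀ i, 0 ≤ f i) {k : ℕ}
    (hk : 1 ≤ k) (h : ∀ s : Finset ι, s.card = k → ∏ i ∈ s, f i ≤ 1) (s : Finset ι)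
    (hs : k ≤ s.card) : ∏ i ∈ s, f i ≤ 1 := by
  obtain ⟨m, hm⟩ : ∃ m, s.card = m := ⟨_, rfl⟩
  rw [hm] at hs
  induction m, hs using Nat.le_induction generalizing s with
  | base => exact h s hm
  | succ m hkm ih =>
    by_contra! hlt
    set P := ∏ i ∈ s, f i
    -- In the double product each `f j` occurs `m` times, so it equals `P ^ m`.
    have h1 : P ^ (m + 1) = P * ∏ i ∈ s, ∏ j ∈ s.erase i, f j := by
      rw [← hm, ← Finset.prod_const, ← Finset.prod_mul_distrib]
      exact Finset.prod_congr rfl fun i hi => (Finset.mul_prod_erase s f hi).symm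
    have h2 : ∏ i ∈ s, ∏ j ∈ s.erase i, f j ≤ 1 :=
      Finset.prod_le_one (fun i _ => Finset.prod_nonneg fun j _ => hf j) fun i hi =>
        ih _ (by rw [Finset.card_erase_of_mem hi]; omega)
    have h3 : P < P ^ (m + 1) := lt_self_pow₀ hlt (by omega)
    nlinarith

/-- Two-sided eigenvalue bounds from an upper bound on `S_k`, `k < n`, and a lower bound on the
determinant. -/
theorem eigenvalues_mem_Icc {A : Matrix (Fin n) (Fin n) ℝ} (hA : A.PosSemidef) {k : ℕ}
    (hk : 1 ≤ k) (hkn : k + 1 ≤ n) (hS : hessianS k A ≤ 1) {δ : ℝ} (hδ : 0 < δ)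
    (hdet : δ ≤ A.det) (i : Fin n) :
    δ ≤ hA.1.eigenvalues i ∧ hA.1.eigenvalues i ≤ (δ ^ (k - 1))⁻¹ := by
  set f := hA.1.eigenvalues
  have hf : ∀ i, 0 ≤ f i := hA.eigenvalues_nonneg
  have hprod : ∀ s : Finset (Fin n), s.card = k → ∏ i ∈ s, f i ≤ 1 := fun s hs => by
    rw [hessianS_eq_sum hA.1] at hS
    refine le_trans ?_ hS
    exact Finset.single_le_sum (f := fun t : Finset (Fin n) => ∏ i ∈ t, f i)
      (fun t _ => Finset.prod_nonneg fun j _ => hf j) (by simp [Finset.mem_powersetCard, hs])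
  have hlow : ∀ i, δ ≤ f i := fun i => by
    have h1 : A.det = f i * ∏ j ∈ Finset.univ.erase i, f j := by
      rw [Finset.mul_prod_erase _ _ (Finset.mem_univ i), hA.1.det_eq_prod_eigenvalues]; rfl
    -- Here `k < n` enters: the other `n - 1 ≥ k` eigenvalues have product at most 1.
    have h2 := prod_le_one_of_card_ge hf hk hprod (Finset.univ.erase i) (by
      rw [Finset.card_erase_of_mem (Finset.mem_univ i)]; simp; omega)
    nlinarith [hf i]
  refine ⟨hlow i, ?_⟩
  -- Any `k - 1` other eigenvalues, each at least `δ`, complete `f i` to a product bounded by 1.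
  obtain ⟨s, hs, hsc⟩ := Finset.exists_subset_card_eq (s := Finset.univ.erase i) (n := k - 1) (by
    rw [Finset.card_erase_of_mem (Finset.mem_univ i)]; simp; omega)
  have his : i ∉ s := fun h => by simpa using hs h
  have h1 := hprod (insert i s) (by rw [Finset.card_insert_of_notMem his]; omega)
  rw [Finset.prod_insert his] at h1
  have h2 : δ ^ (k - 1) ≤ ∏ j ∈ s, f j := by
    rw [← hsc, ← Finset.prod_const]
    exact Finset.prod_le_prod (fun _ _ => hδ.le) fun j _ => hlow j
  rw [← one_div, le_div_iff₀ (pow_pos hδ _)]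
  exact (mul_le_mul_of_nonneg_left h2 (hf i)).trans h1

theorem dotProduct_mulVec_mem_Icc {A : Matrix (Fin n) (Fin n) ℝ} (hA : A.IsHermitian) {a b : ℝ}
    (h : ∀ i, a ≤ hA.eigenvalues i ∧ hA.eigenvalues i ≤ b) (v : Fin n → ℝ) :
    a * (v ⬝ᵥ v) ≤ v ⬝ᵥ A *ᵥ v ∧ v ⬝ᵥ A *ᵥ v ≤ b * (v ⬝ᵥ v) := by
  obtain ⟨U, hU, hU', e⟩ := hA.exists_orthogonal_diagonalization
  set w := Uᵀ *ᵥ v with hw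
  have h1 : v ⬝ᵥ A *ᵥ v = ∑ i, hA.eigenvalues i * (w i * w i) := by
    conv_lhs => rw [e]
    rw [← mulVec_mulVec, ← mulVec_mulVec, ← hw, dotProduct_mulVec, ← mulVec_transpose, ← hw,
      dotProduct]
    refine Finset.sum_congr rfl fun i _ => ?_
    rw [mulVec_diagonal]; ring
  have h2 : v ⬝ᵥ v = ∑ i, w i * w i := by
    change _ = w ⬝ᵥ w
    rw [hw, dotProduct_mulVec, vecMul_transpose, mulVec_mulVec, hU, one_mulVec]
  rw [h1, h2, Finset.mul_sum, Finset.mul_sum]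
  exact ⟨Finset.sum_le_sum fun i _ => mul_le_mul_of_nonneg_right (h i).1 (mul_self_nonneg _),
    Finset.sum_le_sum fun i _ => mul_le_mul_of_nonneg_right (h i).2 (mul_self_nonneg _)⟩

end LinearAlgebra

/-! ### Second-order comparison with a quadratic. -/

section SecondOrder

open Filter Topology Matrix

/-- Were the second derivative negative, `a` would also be a local maximum, so `g` would be locally
constant. -/
theorem IsLocalMin.deriv_deriv_nonneg {g : ℝ → ℝ} {a : ℝ} (h : IsLocalMin g a)
    (hc : ContinuousAt g a) : 0 ≤ deriv (deriv g) a := by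
  by_contra! hneg
  have hmax := isLocalMax_of_deriv_deriv_neg hneg h.deriv_eq_zero hc
  have heq : g =ᶠ[𝓝 a] fun _ => g a := by
    filter_upwards [h, hmax] with t h1 h2 using le_antisymm h2 h1
  have := heq.deriv.deriv_eq
  simp at this
  exact hneg.ne this

/-- Where `u - q` has a local minimum, with `q` quadratic along the line through `x` in direction
`v`, the second derivative of `u` in direction `v` is at least that of `q`. -/
theorem IsLocalMin.two_mul_le_fderiv_fderiv {E : Type*} [NormedAddCommGroup E] [NormedSpace ℝ E]
    {u q : E → ℝ} {x : E} (h : IsLocalMin (fun y => u y - q y) x) (hu : ContDiffAt ℝ 2 u x) (v : E)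
    {b c : ℝ} (hq : ∀ t : ℝ, q (x + t • v) = q x + t * b + t ^ 2 * c) :
    2 * c ≤ fderiv ℝ (fderiv ℝ u) x v v := by
  set ℓ : ℝ → E := fun t => x + t • v with hℓ
  have hℓ0 : ℓ 0 = x := by simp [hℓ]
  have hℓd : ∀ t, HasDerivAt ℓ v t := fun t => by
    have := ((hasDerivAt_id t).smul_const v).const_add x
    rwa [one_smul] at this
  have hℓc : Tendsto ℓ (𝓝 0) (𝓝 x) := by
    simpa [hℓ0] using (hℓd 0).continuousAt.tendsto
  set p : ℝ → ℝ := fun t => q x + t * b + t ^ 2 * c with hp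
  have hpd : ∀ t, HasDerivAt p (b + 2 * t * c) t := fun t => by
    have := (((hasDerivAt_id t).mul_const b).const_add (q x)).add
      (((hasDerivAt_id t).pow 2).mul_const c)
    exact this.congr_deriv (by simp)
  set g : ℝ → ℝ := fun t => u (ℓ t) - p t with hg
  have hmin : IsLocalMin g 0 := by
    have := hℓc.eventually h
    filter_upwards [this] with t ht
    have h0 := hq 0
    have ht' := hq t
    simp only [hg, hp, hℓ] at ht ⊢
    rw [ht'] at ht
    simpa using ht
  have hud : ∀ᶠ y in 𝓝 x, HasFDerivAt u (fderiv ℝ u y) y := by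
    filter_upwards [hu.eventually (by simp)] with y hy
    exact (hy.differentiableAt (by norm_num)).hasFDerivAt
  have hgd : ∀ᶠ t in 𝓝 0, HasDerivAt g (fderiv ℝ u (ℓ t) v - (b + 2 * t * c)) t := by
    filter_upwards [hℓc.eventually hud] with t ht
    exact (ht.comp_hasDerivAt t (hℓd t)).sub (hpd t)
  have hgd' : deriv g =ᶠ[𝓝 0] fun t => fderiv ℝ u (ℓ t) v - (b + 2 * t * c) := by
    filter_upwards [hgd] with t ht using ht.deriv
  have hu2 : HasFDerivAt (fderiv ℝ u) (fderiv ℝ (fderiv ℝ u) x) (ℓ 0) := by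
    rw [hℓ0]
    exact ((hu.fderiv_right (m := 1) (by norm_num)).differentiableAt (by norm_num)).hasFDerivAt
  have hgdd : HasDerivAt (fun t => fderiv ℝ u (ℓ t) v - (b + 2 * t * c))
      (fderiv ℝ (fderiv ℝ u) x v v - 2 * c) 0 := by
    have h1 := (hu2.comp_hasDerivAt 0 (hℓd 0)).clm_apply (hasDerivAt_const 0 v)
    have h2 := (((hasDerivAt_id (0 : ℝ)).const_mul 2).mul_const c).const_add b
    exact (h1.sub h2).congr_deriv (by simp)
  have hnn := hmin.deriv_deriv_nonneg hgd.self_of_nhds.continuousAt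
  rw [hgd'.deriv_eq, hgdd.deriv] at hnn
  linarith

variable {n : ℕ}

theorem dotProduct_hessianMatrix_mulVec (u : EuclideanSpace ℝ (Fin n) → ℝ)
    (x : EuclideanSpace ℝ (Fin n)) (v : Fin n → ℝ) :
    v ⬝ᵥ hessianMatrix u x *ᵥ v =
      fderiv ℝ (fderiv ℝ u) x (WithLp.toLp 2 v) (WithLp.toLp 2 v) := by
  have hv : WithLp.toLp 2 v = ∑ i, v i • EuclideanSpace.single i (1 : ℝ) := by
    ext j
    simp [Pi.single_apply]
  rw [hv]
  simp only [map_sum, map_smul, _root_.sum_apply, _root_.smul_apply,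
    smul_eq_mul, dotProduct, mulVec, hessianMatrix, Matrix.of_apply, Finset.mul_sum]
  rw [Finset.sum_comm]
  refine Finset.sum_congr rfl fun i _ => Finset.sum_congr rfl fun j _ => ?_
  ring

theorem isHermitian_hessianMatrix {u : EuclideanSpace ℝ (Fin n) → ℝ}
    {x : EuclideanSpace ℝ (Fin n)} (hu : ContDiffAt ℝ 2 u x) :
    (hessianMatrix u x).IsHermitian := by
  ext i j
  simpa [hessianMatrix] using
    hu.isSymmSndFDerivAt (by simp) (EuclideanSpace.single j 1) (EuclideanSpace.single i 1)

/-- If a positive semidefinite quadratic form is bounded by one on a bounded domain, its `S_k` is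
at most that of the Hessian of a solution with boundary values one which vanishes at the origin. -/
theorem hessianS_le_one_of_le_one {k : ℕ} (hk : k ≤ n) {Ω : Set (EuclideanSpace ℝ (Fin n))}
    {u : EuclideanSpace ℝ (Fin n) → ℝ} (hΩ : IsOpen Ω) (hb : Bornology.IsBounded Ω) (h0 : 0 ∈ Ω)
    (hu : ContDiffOn ℝ 2 u Ω) (huc : ContinuousOn u (closure Ω))
    (hS : ∀ x ∈ Ω, hessianS k (hessianMatrix u x) = 1) (hu0 : u 0 = 0)
    (hfr : ∀ x ∈ frontier Ω, u x = 1) {M : Matrix (Fin n) (Fin n) ℝ} (hM : M.PosSemidef)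
    (hq : ∀ x ∈ closure Ω, x.ofLp ⬝ᵥ M *ᵥ x.ofLp ≤ 1) : hessianS k M ≤ 1 := by
  -- The factor `1/2` makes the Hessian of `q` equal to `M` and keeps `q ≤ 1/2 < u` on the boundary,
  -- so the minimum of `u - q`, at most 0, is interior.
  set q : EuclideanSpace ℝ (Fin n) → ℝ := fun x => (1 / 2) * (x.ofLp ⬝ᵥ M *ᵥ x.ofLp) with hqdef
  have hqc : Continuous q := by
    simp only [hqdef, dotProduct, mulVec]
    fun_prop
  obtain ⟨x, hx, hmin⟩ := hb.isCompact_closure.exists_isMinOn ⟨0, subset_closure h0⟩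
    (huc.sub hqc.continuousOn)
  have hx0 : u x - q x ≤ 0 := by
    have h1 : u x - q x ≤ u 0 - q 0 := hmin (subset_closure h0)
    simpa [hu0, hqdef] using h1
  have hxΩ : x ∈ Ω := by
    by_contra hn
    have h1 := hfr x (by rw [hΩ.frontier_eq]; exact ⟨hx, hn⟩)
    have h2 := hq x hx
    simp only [hqdef, h1] at hx0
    linarith
  have hloc : IsLocalMin (fun y => u y - q y) x :=
    (hmin.on_subset subset_closure).isLocalMin (hΩ.mem_nhds hxΩ)
  have hux : ContDiffAt ℝ 2 u x := hu.contDiffAt (hΩ.mem_nhds hxΩ)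
  have hherm := isHermitian_hessianMatrix hux
  have hD : (hessianMatrix u x - M).PosSemidef := by
    refine .of_dotProduct_mulVec_nonneg (hherm.sub hM.1) fun v => ?_
    rw [star_trivial, sub_mulVec, dotProduct_sub, sub_nonneg, dotProduct_hessianMatrix_mulVec]
    have h1 := hloc.two_mul_le_fderiv_fderiv hux (WithLp.toLp 2 v)
      (b := (1 / 2) * (x.ofLp ⬝ᵥ M *ᵥ v + v ⬝ᵥ M *ᵥ x.ofLp)) (c := (1 / 2) * (v ⬝ᵥ M *ᵥ v)) (by
        intro t
        simp only [hqdef, WithLp.ofLp_add, WithLp.ofLp_smul, mulVec_add, mulVec_smul,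
          dotProduct_add, add_dotProduct, smul_dotProduct, dotProduct_smul, smul_eq_mul]
        ring)
    linarith
  calc hessianS k M ≤ hessianS k (M + (hessianMatrix u x - M)) := hessianS_le_add hM hD hk
    _ = 1 := by rw [add_sub_cancel, hS x hxΩ]

end SecondOrder

/-! ### Normalisation by a maximal simplex. -/

section MaximalSimplex

open Matrix

variable {n : ℕ}

/-- The columns of `N` maximise `|det|` over `closure Ω`. By Cramer's rule each coordinate of `y` is
the ratio of the determinant with one column replaced by `y` to the maximal one. -/
theorem exists_maximal_simplex {Ω : Set (EuclideanSpace ℝ (Fin n))} (hΩ : IsOpen Ω)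
    (hb : Bornology.IsBounded Ω) (h0 : 0 ∈ Ω) :
    ∃ N : Matrix (Fin n) (Fin n) ℝ, N.det ≠ 0 ∧
      (∀ j, WithLp.toLp 2 (fun i => N i j) ∈ closure Ω) ∧
      ∀ y ∈ closure Ω, ∀ j, |(N⁻¹ *ᵥ y.ofLp) j| ≤ 1 := by
  set f : (Fin n → EuclideanSpace ℝ (Fin n)) → ℝ :=
    fun p => |(Matrix.of fun i j => p j i).det| with hf
  have hfc : Continuous f := by
    refine (Continuous.matrix_det ?_).abs
    refine continuous_matrix fun i j => ?_
    simp only [Matrix.of_apply]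
    fun_prop
  have hK : IsCompact (Set.univ.pi fun _ : Fin n => closure Ω) :=
    isCompact_univ_pi fun _ => hb.isCompact_closure
  obtain ⟨p, hp, hmax⟩ := hK.exists_isMaxOn ⟨fun _ => 0, fun _ _ => subset_closure h0⟩
    hfc.continuousOn
  obtain ⟨ε, hε, hball⟩ := Metric.isOpen_iff.1 hΩ 0 h0
  have hpos : 0 < f p := by
    have h1 : f (fun j => (ε / 2) • EuclideanSpace.single j (1 : ℝ)) ≤ f p := by
      refine hmax fun j _ => subset_closure (hball ?_)
      rw [mem_ball_zero_iff, norm_smul, PiLp.norm_single, Real.norm_eq_abs,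
        abs_of_pos (by positivity)]
      simp; linarith
    refine lt_of_lt_of_le ?_ h1
    have h2 : (Matrix.of fun i j => ((ε / 2) • EuclideanSpace.single j (1 : ℝ) :
        EuclideanSpace ℝ (Fin n)) i) = (ε / 2) • (1 : Matrix (Fin n) (Fin n) ℝ) := by
      ext i j
      simp [Matrix.one_apply]
    simp only [hf, h2, det_smul, det_one, mul_one]
    positivity
  set N : Matrix (Fin n) (Fin n) ℝ := Matrix.of fun i j => p j i with hN
  have hdet : N.det ≠ 0 := abs_pos.1 hpos
  refine ⟨N, hdet, fun j => hp j trivial, fun y hy j => ?_⟩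
  have h1 : f (Function.update p j y) ≤ f p := by
    refine hmax fun i _ => ?_
    by_cases hij : i = j
    · subst hij; simpa using hy
    · simpa [hij] using hp i trivial
  have h2 : (Matrix.of fun i l => Function.update p j y l i) = N.updateCol j y.ofLp := by
    ext i l
    by_cases hlj : l = j
    · subst hlj; simp
    · simp [hlj, hN]
  have h3 : (N⁻¹ *ᵥ y.ofLp) j = N.det⁻¹ * (N.updateCol j y.ofLp).det := by
    rw [inv_def, smul_mulVec, ← cramer_eq_adjugate_mulVec, Pi.smul_apply, cramer_apply,
      Ring.inverse_eq_inv', smul_eq_mul]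
  simp only [hf, h2] at h1
  rw [h3, abs_mul, abs_inv, inv_mul_le_iff₀ hpos, mul_one]
  exact h1

/-- The missing weight `1 - ∑ t j` is placed at the origin. -/
theorem Convex.toLp_mulVec_mem {K : Set (EuclideanSpace ℝ (Fin n))} (hK : Convex ℝ K) (h0 : 0 ∈ K)
    {N : Matrix (Fin n) (Fin n) ℝ} (hN : ∀ j, WithLp.toLp 2 (fun i => N i j) ∈ K) {t : Fin n → ℝ}
    (ht : ∀ j, 0 ≤ t j) (hs : 0 < ∑ j, t j) (hs1 : ∑ j, t j ≤ 1) : WithLp.toLp 2 (N *ᵥ t) ∈ K := by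
  have h1 := hK.centerMass_mem (t := Finset.univ) (fun j _ => ht j) hs fun j _ => hN j
  have h2 := hK.smul_mem_of_zero_mem h0 h1 ⟨hs.le, hs1⟩
  rw [Finset.centerMass, smul_smul, mul_inv_cancel₀ hs.ne', one_smul] at h2
  have e : WithLp.toLp 2 (N *ᵥ t) = ∑ j, t j • WithLp.toLp 2 (fun i => N i j) := by
    ext i
    simp [mulVec, dotProduct, mul_comm]
  rwa [e]

/-- An affine-invariant position for a bounded convex domain containing the origin: in suitable
linear coordinates it lies in a cube and contains a ball, both of fixed size. -/
theorem exists_linear_coordinates [NeZero n] {Ω : Set (EuclideanSpace ℝ (Fin n))} (hΩ : IsOpen Ω)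
    (hconv : Convex ℝ Ω) (hb : Bornology.IsBounded Ω) (h0 : 0 ∈ Ω) :
    ∃ W : Matrix (Fin n) (Fin n) ℝ, W.det ≠ 0 ∧
      (∀ y ∈ closure Ω, ∀ j, |(W *ᵥ y.ofLp) j| ≤ 1) ∧
      W.toEuclideanLin ⁻¹' Metric.ball (WithLp.toLp 2 fun _ => (2 * n : ℝ)⁻¹) (2 * n : ℝ)⁻¹ ⊆ Ω := by
  obtain ⟨N, hdet, hN, hcube⟩ := exists_maximal_simplex hΩ hb h0
  refine ⟨N⁻¹, ?_, hcube, ?_⟩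
  · rw [det_nonsing_inv, Ring.inverse_eq_inv']; exact inv_ne_zero hdet
  have hn : (0 : ℝ) < n := by exact_mod_cast NeZero.pos n
  -- The simplex lies only in the closure, but an open subset of the closure of an open convex set
  -- lies in the set.
  have hint : interior (closure Ω) = Ω := by
    rw [hconv.interior_closure_eq_interior_of_nonempty_interior
      ⟨0, by rwa [hΩ.interior_eq]⟩, hΩ.interior_eq]
  rw [← hint]
  refine interior_maximal ?_ (Metric.isOpen_ball.preimage
    (LinearMap.continuous_of_finiteDimensional _))
  intro y hy
  rw [Set.mem_preimage, mem_ball_iff_norm] at hy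
  set t : Fin n → ℝ := N⁻¹ *ᵥ y.ofLp with ht
  have hcoord : ∀ j, |t j - (2 * n : ℝ)⁻¹| < (2 * n : ℝ)⁻¹ := fun j => by
    refine lt_of_le_of_lt ?_ hy
    exact PiLp.norm_apply_le (N⁻¹.toEuclideanLin y - WithLp.toLp 2 fun _ => (2 * n : ℝ)⁻¹) j
  have htpos : ∀ j, 0 < t j := fun j => by linarith [(abs_lt.1 (hcoord j)).1]
  have htle : ∀ j, t j ≤ (n : ℝ)⁻¹ := fun j => by
    have := (abs_lt.1 (hcoord j)).2
    have e : (2 * n : ℝ)⁻¹ + (2 * n : ℝ)⁻¹ = (n : ℝ)⁻¹ := by field_simp; norm_num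
    linarith
  have hsum : ∑ j, t j ≤ 1 := by
    calc ∑ j, t j ≤ ∑ _j : Fin n, (n : ℝ)⁻¹ := Finset.sum_le_sum fun j _ => htle j
      _ = 1 := by simp [hn.ne']
  have hy' : y = WithLp.toLp 2 (N *ᵥ t) := by
    rw [ht, mulVec_mulVec, mul_nonsing_inv _ hdet.isUnit, one_mulVec]
  rw [hy']
  exact hconv.closure.toLp_mulVec_mem (subset_closure h0) hN (fun j => (htpos j).le)
    (Finset.sum_pos (fun j _ => htpos j) Finset.univ_nonempty) hsum

theorem det_toEuclideanLin (W : Matrix (Fin n) (Fin n) ℝ) :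
    LinearMap.det W.toEuclideanLin = W.det := by
  rw [Matrix.toEuclideanLin, toLpLin_eq_toLin, LinearMap.det_toLin]

/-- A lower bound for the determinant of linear coordinates in which a set of volume `V` contains
a given ball. -/
theorem volume_ball_div_le_abs_det {Ω : Set (EuclideanSpace ℝ (Fin n))} {V : ℝ} (hV : 0 < V)
    (hvol : volume Ω = ENNReal.ofReal V) {W : Matrix (Fin n) (Fin n) ℝ} (hW : W.det ≠ 0)
    {c : EuclideanSpace ℝ (Fin n)} {r : ℝ} (h : W.toEuclideanLin ⁻¹' Metric.ball c r ⊆ Ω) :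
    (volume (Metric.ball (0 : EuclideanSpace ℝ (Fin n)) r)).toReal / V ≤ |W.det| := by
  have h1 := measure_mono (μ := volume) h
  rw [Measure.addHaar_preimage_linearMap _ (by rwa [det_toEuclideanLin]), det_toEuclideanLin, hvol,
    Measure.addHaar_ball_center] at h1
  have h2 := ENNReal.toReal_mono ENNReal.ofReal_ne_top h1
  rw [ENNReal.toReal_mul, ENNReal.toReal_ofReal (abs_nonneg _), ENNReal.toReal_ofReal hV.le,
    abs_inv, inv_mul_le_iff₀ (abs_pos.2 hW)] at h2
  rwa [div_le_iff₀ hV]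

end MaximalSimplex

/-! ### Constants and conclusion. -/

open Matrix in
theorem theorem6p1 (n k : ℕ) (hk : 1 ≤ k) (hkn : k + 1 ≤ n) (V : ℝ) (hV : 0 < V) :
    ∃ γ : ℝ, 1 < γ ∧
      ∀ (Ω : Set (EuclideanSpace ℝ (Fin n))) (u : EuclideanSpace ℝ (Fin n) → ℝ),
        IsOpen Ω → Convex ℝ Ω → Bornology.IsBounded Ω → volume Ω = ENNReal.ofReal V →
        (0 : EuclideanSpace ℝ (Fin n)) ∈ Ω →
        ContDiffOn ℝ 2 u Ω → ContinuousOn u (closure Ω) → ConvexOn ℝ Ω u →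
        (∀ x ∈ Ω, hessianS k (hessianMatrix u x) = 1) →
        u 0 = 0 → fderiv ℝ u 0 = 0 → (∀ x ∈ frontier Ω, u x = 1) →
        GammaBallCondition γ Ω := by
  have hn : (0 : ℝ) < n := by exact_mod_cast (by omega : 0 < n)
  have : NeZero n := ⟨by omega⟩
  set r : ℝ := (2 * n : ℝ)⁻¹ with hr
  have hr0 : 0 < r := by positivity
  -- `β` bounds `|det W|` below, `δ` bounds `det M` and its eigenvalues below, and `D` bounds the
  -- eigenvalues above; `ρ` is the inner radius and `d` bounds `‖x‖` on `Ω`.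
  set β : ℝ := (volume (Metric.ball (0 : EuclideanSpace ℝ (Fin n)) r)).toReal / V with hβ
  have hβ0 : 0 < β := div_pos (ENNReal.toReal_pos (Metric.measure_ball_pos _ _ hr0).ne'
    Metric.isBounded_ball.measure_lt_top.ne) hV
  set δ : ℝ := (n : ℝ)⁻¹ ^ n * β ^ 2 with hδ
  have hδ0 : 0 < δ := by positivity
  set D : ℝ := (δ ^ (k - 1))⁻¹ with hD
  have hD0 : 0 < D := by positivity
  set ρ : ℝ := r / √(n * D) with hρ
  have hρ0 : 0 < ρ := by positivity
  set d : ℝ := √(δ⁻¹) with hd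
  have hd0 : 0 < d := by positivity
  -- With `R = 1`, the term `ρ⁻¹` serves the inner ball and `2 * d` bounds distances within `Ω`.
  refine ⟨2 * d + 1 + ρ⁻¹, by linarith [inv_pos.2 hρ0], ?_⟩
  intro Ω u hΩ hconv hb hvol h0 hu huc _ hS hu0 _ hfr
  obtain ⟨W, hW, hcube, hball⟩ := exists_linear_coordinates hΩ hconv hb h0
  have hWdet : β ≤ |W.det| := volume_ball_div_le_abs_det hV hvol hW hball
  set M : Matrix (Fin n) (Fin n) ℝ := (n : ℝ)⁻¹ • (Wᵀ * W) with hM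
  have hMpsd : M.PosSemidef := by
    have h1 := posSemidef_conjTranspose_mul_self W
    rw [conjTranspose_eq_transpose_of_trivial] at h1
    exact h1.smul (by positivity)
  have hMq : ∀ v : Fin n → ℝ, v ⬝ᵥ M *ᵥ v = (n : ℝ)⁻¹ * ∑ j, (W *ᵥ v) j ^ 2 := fun v => by
    rw [hM, smul_mulVec, dotProduct_smul, smul_eq_mul, ← mulVec_mulVec, dotProduct_mulVec,
      vecMul_transpose]
    simp [dotProduct, sq]
  have hM1 : ∀ x ∈ closure Ω, x.ofLp ⬝ᵥ M *ᵥ x.ofLp ≤ 1 := fun x hx => by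
    rw [hMq, inv_mul_le_iff₀ hn, mul_one]
    calc ∑ j, (W *ᵥ x.ofLp) j ^ 2 ≤ ∑ _j : Fin n, (1 : ℝ) :=
          Finset.sum_le_sum fun j _ => (sq_le_one_iff_abs_le_one _).2 (hcube x hx j)
      _ = n := by simp
  have hMS := hessianS_le_one_of_le_one (by omega) hΩ hb h0 hu huc hS hu0 hfr hMpsd hM1
  have hMdet : δ ≤ M.det := by
    have e : M.det = (n : ℝ)⁻¹ ^ n * |W.det| ^ 2 := by
      rw [hM, det_smul, det_mul, det_transpose, Fintype.card_fin, sq_abs, sq]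
    rw [e]
    exact mul_le_mul_of_nonneg_left (pow_le_pow_left₀ hβ0.le hWdet 2) (by positivity)
  have hform := dotProduct_mulVec_mem_Icc hMpsd.1
    (eigenvalues_mem_Icc hMpsd hk hkn hMS hδ0 hMdet)
  have hnorm : ∀ x : EuclideanSpace ℝ (Fin n), x.ofLp ⬝ᵥ x.ofLp = ‖x‖ ^ 2 := fun x => by
    rw [EuclideanSpace.real_norm_sq_eq]; simp [dotProduct, sq]
  have hbound : ∀ x ∈ Ω, ‖x‖ ≤ d := fun x hx => by
    have h1 := (hform x.ofLp).1.trans (hM1 x (subset_closure hx))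
    rw [hnorm] at h1
    rw [hd]
    refine Real.le_sqrt_of_sq_le ?_
    rwa [← one_div, le_div_iff₀ hδ0, mul_comm]
  set c : EuclideanSpace ℝ (Fin n) := WithLp.toLp 2 fun _ => r with hc
  set x₁ : EuclideanSpace ℝ (Fin n) := W⁻¹.toEuclideanLin c with hx₁
  have hWx₁ : W.toEuclideanLin x₁ = c := by
    simp [hx₁, toLpLin_apply, mulVec_mulVec, mul_nonsing_inv _ hW.isUnit]
  have hin : Metric.ball x₁ ρ ⊆ Ω := by
    refine subset_trans (fun y hy => ?_) hball
    rw [mem_ball_iff_norm] at hy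
    rw [Set.mem_preimage, mem_ball_iff_norm]
    change ‖W.toEuclideanLin y - c‖ < r
    rw [← hWx₁, ← map_sub]
    -- Since `‖Wz‖² = n (z·Mz)`, the eigenvalue bound `D` makes `W` Lipschitz with constant `√(n
    -- D)`.
    have h1 : ‖W.toEuclideanLin (y - x₁)‖ ^ 2 ≤ n * D * ‖y - x₁‖ ^ 2 := by
      have h2 := (hform (y - x₁).ofLp).2
      rw [hMq, hnorm, inv_mul_le_iff₀ hn] at h2
      rw [EuclideanSpace.real_norm_sq_eq, mul_assoc]
      exact h2
    refine lt_of_pow_lt_pow_left₀ 2 hr0.le (h1.trans_lt ?_)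
    have h3 : r ^ 2 = n * D * ρ ^ 2 := by
      rw [hρ, div_pow, Real.sq_sqrt (by positivity)]
      field_simp
    rw [h3]
    gcongr
  have hx₁Ω : x₁ ∈ Ω := hin (Metric.mem_ball_self hρ0)
  have hγ : ρ⁻¹ ≤ 2 * d + 1 + ρ⁻¹ := by linarith
  refine ⟨x₁, 1, one_pos, ?_, fun y hy => ?_⟩
  · rw [mul_one]
    refine (Metric.ball_subset_ball ?_).trans hin
    exact inv_le_of_inv_le₀ hρ0 hγ
  · rw [mul_one, mem_ball_iff_norm]
    have := norm_sub_le y x₁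
    linarith [hbound y hy, hbound x₁ hx₁Ω, inv_pos.2 hρ0]
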